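/- Let $B_{c_0}$ be the open unit ball of the complex Banach space $c_0$ of null sequences. Let $\mathcal H^\infty(B_{c_0})$ be the Banach algebra of bounded holomorphic functions $B_{c_0}\to\mathbb C$, let $\mathcal A_u(B_{c_0})$ be the subalgebra of uniformly continuous holomorphic functions, and let $\mathcal H^\infty(B_{c_0},\ell_\infty)$ be the space of bounded holomorphic functions $B_{c_0}\to\ell_\infty$, all with the supremum norm. Let $$\mathcal M_{u,\infty}(B_{c_0},B_{c_0})=\{\Phi:\mathcal A_u(B_{c_0})\to\mathcal H^\infty(B_{c_0})\ \text{nonzero algebra homomorphisms}\},$$ and for $\Phi\in\mathcal M_{u,\infty}(B_{c_0},B_{c_0})$ let its Gleason part be $$\mathcal{GP}(\Phi)=\{\Psi\in\mathcal M_{u,\infty}(B_{c_0},B_{c_0}):\ \|\Phi-\Psi\|<2\},$$ where $\|\Phi-\Psi\|=\sup\{|\Phi(f)(x)-\Psi(f)(x)|:\ f\in\mathcal A_u(B_{c_0}),\ \|f\|\le 1,\ x\in B_{c_0}\}$. The element $\Phi$ is called isolated in the Gleason metric if $\mathcal{GP}(\Phi)=\{\Phi\}$. For $f\in\mathcal A_u(B_{c_0})$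 let $\widetilde f$ be its canonical extension to the closed unit ball of $\ell_\infty=c_0^{**}$, that is, the Aron–Berner extension of $f$ to the open unit ball of $\ell_\infty$, extended by continuity to the closed ball. For $g$ in the closed unit ball of $\mathcal H^\infty(B_{c_0},\ell_\infty)$ let $C_g\in\mathcal M_{u,\infty}(B_{c_0},B_{c_0})$ be the composition homomorphism $C_g(f)=\widetilde f\circ g$. **Proposition.** Let $g$ belong to the closed unit ball of $\mathcal H^\infty(B_{c_0},\ell_\infty)$. If $C_g$ is isolated in the Gleason metric of $\mathcal M_{u,\infty}(B_{c_0},B_{c_0})$, then $g$ is an extreme point of the closed unit ball of $\mathcal H^\infty(B_{c_0},\ell_\infty)$. -/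

import Mathlib

open Set Metric Filter Topology BoundedContinuousFunction
open scoped ENNReal ZeroAtInfty

noncomputable section

namespace VectorSpectrum

/-! ### Bounded holomorphic functions on the open unit ball of a complex normed space -/

section Holomorphic

variable {E F : Type*} [NormedAddCommGroup E] [NormedSpace ℂ E]
  [NormedAddCommGroup F] [NormedSpace ℂ F]

/-- A function on the open unit ball of `E`, extended by zero to all of `E`. -/
def extendZero (f : ball (0 : E) 1 → F) : E → F :=
  Function.extend Subtype.val f 0

theorem extendZero_apply (f : ball (0 : E) 1 → F) {x : E} (hx : x ∈ ball (0 : E) 1) :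
    extendZero f x = f ⟨x, hx⟩ :=
  Subtype.val_injective.extend_apply f 0 ⟨x, hx⟩

/-- Holomorphy (complex Fréchet differentiability) on the open unit ball of `E`. -/
def IsHolomorphic (f : ball (0 : E) 1 → F) : Prop :=
  DifferentiableOn ℂ (extendZero f) (ball (0 : E) 1)

theorem isHolomorphic_const (c : F) : IsHolomorphic (fun _ : ball (0 : E) 1 => c) :=
  (differentiableOn_const c).congr fun _ hx => extendZero_apply _ hx

theorem IsHolomorphic.add {f g : ball (0 : E) 1 → F} (hf : IsHolomorphic f)
    (hg : IsHolomorphic g) : IsHolomorphic (fun x => f x + g x) :=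
  (DifferentiableOn.add hf hg).congr fun x hx => by
    simp [extendZero_apply _ hx]

theorem IsHolomorphic.smul {f : ball (0 : E) 1 → F} (c : ℂ) (hf : IsHolomorphic f) :
    IsHolomorphic (fun x => c • f x) :=
  (DifferentiableOn.const_smul hf c).congr fun x hx => by
    simp [extendZero_apply _ hx]

theorem IsHolomorphic.mul {f g : ball (0 : E) 1 → ℂ} (hf : IsHolomorphic f)
    (hg : IsHolomorphic g) : IsHolomorphic (fun x => f x * g x) :=
  (DifferentiableOn.mul hf hg).congr fun x hx => by
    simp [extendZero_apply _ hx]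

variable (E F) in
/-- `H^∞(B_E, F)`: the bounded holomorphic functions from the open unit ball of `E` to `F`, with
the supremum norm. -/
def HInfty : Submodule ℂ (ball (0 : E) 1 →ᵇ F) where
  carrier := {f | IsHolomorphic f}
  add_mem' hf hg := IsHolomorphic.add hf hg
  zero_mem' := isHolomorphic_const 0
  smul_mem' c _ hf := IsHolomorphic.smul c hf

variable (E) in
/-- The Banach algebra `H^∞(B_E)` of bounded holomorphic scalar functions. -/
def HInftyAlg : Subalgebra ℂ (ball (0 : E) 1 →ᵇ ℂ) where
  carrier := {f | IsHolomorphic f}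
  add_mem' hf hg := IsHolomorphic.add hf hg
  mul_mem' hf hg := IsHolomorphic.mul hf hg
  algebraMap_mem' c := isHolomorphic_const c

theorem uniformContinuous_mul_of_bounded {f g : ball (0 : E) 1 →ᵇ ℂ}
    (hf : UniformContinuous f) (hg : UniformContinuous g) :
    UniformContinuous (f * g : ball (0 : E) 1 →ᵇ ℂ) := by
  rw [Metric.uniformContinuous_iff] at hf hg ⊢
  intro ε hε
  set M : ℝ := ‖f‖ + ‖g‖ + 1 with hM
  have hMpos : 0 < M := by positivity
  obtain ⟨δ₁, hδ₁, h₁⟩ := hf (ε / (2 * M)) (by positivity)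
  obtain ⟨δ₂, hδ₂, h₂⟩ := hg (ε / (2 * M)) (by positivity)
  refine ⟨min δ₁ δ₂, lt_min hδ₁ hδ₂, fun {a b} hab => ?_⟩
  have k₁ := h₁ (lt_of_lt_of_le hab (min_le_left _ _))
  have k₂ := h₂ (lt_of_lt_of_le hab (min_le_right _ _))
  rw [dist_eq_norm] at k₁ k₂ ⊢
  have e : (f * g) a - (f * g) b = f a * (g a - g b) + (f a - f b) * g b := by
    simp only [BoundedContinuousFunction.mul_apply]; ring
  have b₁ : ‖f a‖ ≤ M := (f.norm_coe_le_norm a).trans (by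
    have := norm_nonneg g; linarith)
  have b₂ : ‖g b‖ ≤ M := (g.norm_coe_le_norm b).trans (by
    have := norm_nonneg f; linarith)
  calc ‖(f * g) a - (f * g) b‖ ≤ ‖f a‖ * ‖g a - g b‖ + ‖f a - f b‖ * ‖g b‖ := by
        rw [e, ← norm_mul, ← norm_mul]; exact norm_add_le _ _
    _ ≤ M * ‖g a - g b‖ + ‖f a - f b‖ * M := by gcongr
    _ < M * (ε / (2 * M)) + (ε / (2 * M)) * M := by gcongr
    _ = ε := by field_simp; ring

variable (E) in
/-- The Banach algebra `A_u(B_E)` of uniformly continuous holomorphic scalar functions (such a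
function is automatically bounded, the ball being bounded and convex). -/
def AU : Subalgebra ℂ (ball (0 : E) 1 →ᵇ ℂ) where
  carrier := {f | IsHolomorphic f ∧ UniformContinuous f}
  add_mem' hf hg := ⟨IsHolomorphic.add hf.1 hg.1, UniformContinuous.add hf.2 hg.2⟩
  mul_mem' hf hg := ⟨IsHolomorphic.mul hf.1 hg.1, uniformContinuous_mul_of_bounded hf.2 hg.2⟩
  algebraMap_mem' c := ⟨isHolomorphic_const c, uniformContinuous_const⟩

end Holomorphic

/-! ### The canonical (Aron–Berner) extension to the bidual -/

section Extension

variable {E : Type*} [NormedAddCommGroup E] [NormedSpace ℂ E]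

/-- For `z` in the bidual of `E` and a continuous `m`-linear form `A` on `E`, the value
`Ã(z, …, z)` of the Arens extension of `A`:
`Ã(z₁, …, zₘ) = z₁ (x₁ ↦ z₂ (x₂ ↦ ⋯ zₘ (xₘ ↦ A (x₁, …, xₘ)) ⋯ ))`.
It is continuous and linear in `A`, which is what makes the recursion meaningful. -/
def arensEval (z : StrongDual ℂ (StrongDual ℂ E)) :
    (m : ℕ) → (E [×m]→L[ℂ] ℂ) →L[ℂ] ℂ
  | 0 => ((continuousMultilinearCurryFin0 ℂ E ℂ).toContinuousLinearEquiv :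
      (E [×0]→L[ℂ] ℂ) →L[ℂ] ℂ)
  | m + 1 => z ∘L ContinuousLinearMap.compL ℂ E (E [×m]→L[ℂ] ℂ) ℂ (arensEval z m) ∘L
      ((continuousMultilinearCurryLeftEquiv ℂ (fun _ : Fin (m + 1) => E)
        ℂ).toContinuousLinearEquiv :
        (E [×(m + 1)]→L[ℂ] ℂ) →L[ℂ] (E →L[ℂ] (E [×m]→L[ℂ] ℂ)))

/-- The Aron–Berner extension, at a point `z` of the open unit ball of the bidual: the Taylor
series of `f` at `0` is extended term by term. -/
def aronBerner (f : ball (0 : E) 1 → ℂ) (z : StrongDual ℂ (StrongDual ℂ E)) : ℂ :=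
  ∑' m : ℕ, ((m.factorial : ℂ)⁻¹) * arensEval z m (iteratedFDeriv ℂ m (extendZero f) 0)

/-- The canonical extension `f̃` of `f ∈ A_u(B_E)` to the closed unit ball of the bidual: the
Aron–Berner extension on the open ball, extended by continuity to the sphere. -/
def canonicalExtension (f : ball (0 : E) 1 → ℂ) : StrongDual ℂ (StrongDual ℂ E) → ℂ :=
  extendFrom (ball (0 : StrongDual ℂ (StrongDual ℂ E)) 1) (aronBerner f)

end Extension

/-! ### The spaces `c₀` and `ℓ_∞ = c₀**` -/

/-- The space `c₀` of complex null sequences. -/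
abbrev c0 : Type := C₀(ℕ, ℂ)

/-- The space `ℓ_∞` of bounded complex sequences. -/
abbrev ellInfty : Type := lp (fun _ : ℕ => ℂ) ∞

/-- A finitely supported sequence, as an element of `c₀`. -/
def c0OfFinset (s : Finset ℕ) (a : ℕ → ℂ) : c0 where
  toFun i := if i ∈ s then a i else 0
  continuous_toFun := continuous_of_discreteTopology
  zero_at_infty' := by
    rw [Filter.cocompact_eq_cofinite]
    refine tendsto_const_nhds.congr' ?_
    filter_upwards [s.finite_toSet.compl_mem_cofinite] with i hi
    have : i ∉ s := by simpa using hi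
    simp [this]

/-- The unit vectors of `c₀`. -/
def unitVec (i : ℕ) : c0 := c0OfFinset {i} 1

theorem c0OfFinset_eq_sum (s : Finset ℕ) (a : ℕ → ℂ) :
    c0OfFinset s a = ∑ i ∈ s, a i • unitVec i := by
  ext j
  have h : ∀ t : Finset ℕ, (∑ i ∈ t, a i • unitVec i : c0) j = if j ∈ t then a j else 0 := by
    intro t
    induction t using Finset.induction_on with
    | empty => simp
    | insert i t hi ih =>
      rw [Finset.sum_insert hi, ZeroAtInftyContinuousMap.add_apply, ih]
      by_cases hji : j = i
      · subst hji
        simp [unitVec, c0OfFinset, hi]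
      · simp [unitVec, c0OfFinset, hji]
  rw [h]
  rfl

theorem norm_c0OfFinset_le (s : Finset ℕ) (a : ℕ → ℂ) (ha : ∀ i, ‖a i‖ ≤ 1) :
    ‖c0OfFinset s a‖ ≤ 1 := by
  rw [← ZeroAtInftyContinuousMap.norm_toBCF_eq_norm,
    BoundedContinuousFunction.norm_le zero_le_one]
  intro i
  change ‖(if i ∈ s then a i else 0 : ℂ)‖ ≤ 1
  split_ifs
  · exact ha i
  · simp

/-- The dual of `c₀` embeds contractively in `ℓ₁` through the values on the unit vectors. -/
theorem sum_norm_unitVec_le (φ : StrongDual ℂ c0) (s : Finset ℕ) :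
    ∑ i ∈ s, ‖φ (unitVec i)‖ ≤ ‖φ‖ := by
  set a : ℕ → ℂ := fun i => (starRingEnd ℂ) (φ (unitVec i)) / ‖φ (unitVec i)‖ with ha
  have ha1 : ∀ i, ‖a i‖ ≤ 1 := by
    intro i
    simp only [ha, norm_div, RCLike.norm_conj, Complex.norm_real, norm_norm]
    exact div_self_le_one _
  have h1 : φ (c0OfFinset s a) = ((∑ i ∈ s, ‖φ (unitVec i)‖ : ℝ) : ℂ) := by
    rw [c0OfFinset_eq_sum, map_sum, Complex.ofReal_sum]
    refine Finset.sum_congr rfl fun i _ => ?_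
    rw [map_smul, smul_eq_mul]
    by_cases h0 : φ (unitVec i) = 0
    · simp [h0]
    · have : ((‖φ (unitVec i)‖ : ℝ) : ℂ) ≠ 0 := by simpa using h0
      simp only [ha]
      rw [div_mul_eq_mul_div, Complex.conj_mul', sq, mul_div_assoc, div_self this, mul_one]
  have h2 : ‖φ (c0OfFinset s a)‖ ≤ ‖φ‖ * 1 :=
    (φ.le_opNorm _).trans (by gcongr; exact norm_c0OfFinset_le s a ha1)
  rw [h1, Complex.norm_real, mul_one] at h2
  exact (le_abs_self _).trans h2

theorem summable_norm_unitVec (φ : StrongDual ℂ c0) : Summable fun i => ‖φ (unitVec i)‖ :=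
  summable_of_sum_le (fun _ => norm_nonneg _) (sum_norm_unitVec_le φ)

theorem summable_norm_pairing (z : ellInfty) (φ : StrongDual ℂ c0) :
    Summable fun i => ‖φ (unitVec i) * z i‖ := by
  refine Summable.of_nonneg_of_le (fun _ => norm_nonneg _) (fun i => ?_)
    ((summable_norm_unitVec φ).mul_right ‖z‖)
  rw [norm_mul]
  gcongr
  exact lp.norm_apply_le_norm ENNReal.top_ne_zero z i

/-- The canonical identification of `ℓ_∞` with the bidual of `c₀`: the sequence `z` acts on
`φ ∈ c₀* = ℓ₁` by `φ ↦ ∑ᵢ φ(eᵢ) zᵢ`. -/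
def toBidual (z : ellInfty) : StrongDual ℂ (StrongDual ℂ c0) :=
  LinearMap.mkContinuous
    { toFun := fun φ => ∑' i, φ (unitVec i) * z i
      map_add' := fun φ ψ => by
        rw [← (summable_norm_pairing z φ).of_norm.tsum_add (summable_norm_pairing z ψ).of_norm]
        exact tsum_congr fun i => by rw [_root_.add_apply, add_mul]
      map_smul' := fun c φ => by
        rw [RingHom.id_apply, smul_eq_mul, ← tsum_mul_left]
        exact tsum_congr fun i => by
          rw [_root_.smul_apply, smul_eq_mul, mul_assoc] }
    ‖z‖ fun (φ : StrongDual ℂ c0) => by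
      have hs := summable_norm_pairing z φ
      refine (norm_tsum_le_tsum_norm hs).trans ?_
      have h1 : ∑' i, ‖φ (unitVec i) * z i‖ ≤ ∑' i, ‖φ (unitVec i)‖ * ‖z‖ := by
        refine hs.tsum_le_tsum (fun i => ?_) ((summable_norm_unitVec φ).mul_right ‖z‖)
        rw [norm_mul]
        gcongr
        exact lp.norm_apply_le_norm ENNReal.top_ne_zero z i
      refine h1.trans ?_
      rw [tsum_mul_right, mul_comm]
      gcongr
      exact (summable_norm_unitVec φ).tsum_le_of_sum_le (sum_norm_unitVec_le φ)

/-! ### The spectrum `M_{u,∞}(B_{c₀}, B_{c₀})`, composition homomorphisms, Gleason parts -/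

/-- Arbitrary maps from `A_u(B_{c₀})` to the complex functions on the open unit ball of `c₀`. -/
abbrev FunctionMap : Type := AU c0 → ball (0 : c0) 1 → ℂ

/-- `M_{u,∞}(B_{c₀}, B_{c₀})`: the nonzero algebra homomorphisms
`A_u(B_{c₀}) → H^∞(B_{c₀})`. -/
def spectrumUInfty : Set FunctionMap :=
  {T | ∃ Φ : AU c0 →ₙₐ[ℂ] HInftyAlg c0, Φ ≠ 0 ∧
    ∀ (f : AU c0) (x : ball (0 : c0) 1), T f x = (Φ f : ball (0 : c0) 1 →ᵇ ℂ) x}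

/-- `C_g`, given by `C_g(f) = f̃ ∘ g`. -/
def compositionMap (g : HInfty c0 ellInfty) : FunctionMap :=
  fun f x => canonicalExtension (f : ball (0 : c0) 1 →ᵇ ℂ)
    (toBidual ((g : ball (0 : c0) 1 →ᵇ ellInfty) x))

/-- The Gleason distance: the operator norm
`‖S - T‖ = sup {|S(f)(x) - T(f)(x)| : ‖f‖ ≤ 1, ‖x‖ < 1}`, valued in `[0, ∞]`. -/
def gleasonDist (S T : FunctionMap) : ℝ≥0∞ :=
  ⨆ (f : AU c0) (_ : ‖f‖ ≤ 1) (x : ball (0 : c0) 1), ‖S f x - T f x‖ₑ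

/-- The Gleason part `{Ψ ∈ M_{u,∞}(B_{c₀}, B_{c₀}) : ‖Φ - Ψ‖ < 2}`. -/
def gleasonPart (Φ : FunctionMap) : Set FunctionMap :=
  {Ψ ∈ spectrumUInfty | gleasonDist Φ Ψ < 2}

/-- `Φ` is isolated in the Gleason metric of `M_{u,∞}(B_{c₀}, B_{c₀})`: its Gleason part is
`{Φ}`. -/
def IsGleasonIsolated (Φ : FunctionMap) : Prop :=
  gleasonPart Φ = {Φ}

end VectorSpectrum

end

/-!
If `g` is not extreme, there is `h ≠ 0` in `H^∞(B_{c₀}, ℓ_∞)` with `‖g ± h‖ ≤ 1`. By the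
parallelogram law, `|hᵢ(x)|² / 2 ≤ 1 - |gᵢ(x)|` in every coordinate, so for every `x` the analytic
disc `t ↦ g(x) + t h(x)² / 2`, `|t| < 1`, stays in the closed unit ball of `ℓ_∞` (products are
coordinatewise; see `ellInfty_norm_add_smul_sq_le`). The Schwarz lemma on this disc, applied to
`f̃` with `‖f‖ ≤ 1`, gives `|f̃(g(x)) - f̃(g(x) + h(x)² / 4)| ≤ 1` uniformly in `f` and `x`
(`norm_canonicalExtension_sub_le`). Hence composition with `g + h² / 4` lies in the Gleason part of
`C_g`, and it differs from `C_g` on a coordinate function. This contradicts isolation.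

The argument needs that `f̃` is multiplicative and bounded by `‖f‖`, and that it is holomorphic
along holomorphic maps into the closed ball of the bidual. All of this follows once `f̃` is a pointwise
limit of values of `f` itself: `f̃(ζ) = lim f(r_N ζ_N)`, where `ζ_N` is the `N`-th truncation of `ζ`
and `r_N` increases to `1` (`tendsto_canonicalExtension`). Holomorphy passes to the limit because a
bounded pointwise limit of holomorphic maps is holomorphic
(`differentiableAt_of_tendsto_of_bounded`).

To obtain the limit formula, `f` is expanded in its Taylor series at `0`. A Fréchet-holomorphic map
is smooth, its homogeneous Taylor terms satisfy the Cauchy estimates along complex lines, and these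
dominate the series along the truncations. For a single multilinear form, the iterated limit that
defines the Arens extension has to be replaced by the diagonal limit (`tendsto_apply_trunc`). This
is the special feature of `c₀`: by induction on the degree, the functionals obtained by truncating all
but one argument form a weakly Cauchy sequence in `c₀* = ℓ₁`, which converges in norm by Schur's
theorem (`cauchySeq_of_weakly_cauchySeq`).
-/

noncomputable section

namespace VectorSpectrum

universe u

/-! ### Holomorphic maps on open subsets of complex normed spaces -/

section BanachHolomorphy

variable {E F : Type*} [NormedAddCommGroup E] [NormedSpace ℂ E]
  [NormedAddCommGroup F] [NormedSpace ℂ F] {f : E → F} {c : E} {R M : ℝ}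

theorem norm_fderiv_le_of_norm_le (hR : 0 < R) (hd : DifferentiableOn ℂ f (ball c R))
    (hM : ∀ x ∈ ball c R, ‖f x‖ ≤ M) : ‖fderiv ℂ f c‖ ≤ 2 * M / R := by
  refine Complex.norm_fderiv_le_div_of_mapsTo_ball hd (fun x hx => ?_) hR
  rw [mem_closedBall, dist_eq_norm]
  have h1 := hM x hx
  have h2 := hM c (mem_ball_self hR)
  linarith [norm_sub_le (f x) (f c)]

/-- The first-order Taylor remainder of a bounded holomorphic map is quadratic, with a constant
depending only on the bound. This is the Schwarz lemma for a map vanishing to second order. -/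
theorem norm_sub_fderiv_le (hR : 0 < R) (hd : DifferentiableOn ℂ f (ball c R))
    (hM : ∀ x ∈ ball c R, ‖f x‖ ≤ M) {w : E} (hw : w ∈ ball c R) :
    ‖f w - f c - fderiv ℂ f c (w - c)‖ ≤ 4 * M * (‖w - c‖ / R) ^ 2 := by
  have hc := mem_ball_self (x := c) hR
  have hdc : DifferentiableAt ℂ f c := hd.differentiableAt (ball_mem_nhds c hR)
  have hd' : DifferentiableOn ℂ (fun x => f x - fderiv ℂ f c (x - c)) (ball c R) :=
    hd.sub (by fun_prop)
  have h := Complex.dist_le_mul_div_pow_of_mapsTo_ball_of_isLittleO (n := 1) (R₂ := 4 * M) hd'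
    (fun x hx => ?_) ?_ hw
  · rw [dist_eq_norm, dist_eq_norm] at h
    convert! h using 2
    simp only [sub_self, map_zero, sub_zero]
    abel
  · rw [mem_closedBall, dist_eq_norm]
    simp only [sub_self, map_zero, sub_zero]
    have h1 := hM x hx
    have h2 := hM c hc
    have h3 : ‖fderiv ℂ f c (x - c)‖ ≤ 2 * M := by
      refine ((fderiv ℂ f c).le_opNorm _).trans ?_
      have h4 := norm_fderiv_le_of_norm_le hR hd hM
      have h5 : ‖x - c‖ ≤ R := by rw [← dist_eq_norm]; exact (mem_ball.1 hx).le
      calc _ ≤ 2 * M / R * R := by gcongr; exact (norm_nonneg _).trans h4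
        _ = 2 * M := by field_simp
    have h6 := norm_sub_le (f x - fderiv ℂ f c (x - c)) (f c)
    have h7 := norm_sub_le (f x) (fderiv ℂ f c (x - c))
    linarith
  · have h := hdc.hasFDerivAt.isLittleO.norm_right
    simp only [pow_one, sub_self, map_zero, sub_zero]
    refine h.congr_left fun x => ?_
    abel

theorem hasFDerivAt_of_norm_sub_le_sq {L : E →L[ℂ] F} {K : ℝ} (hR : 0 < R)
    (h : ∀ w ∈ ball c R, ‖f w - f c - L (w - c)‖ ≤ K * (‖w - c‖ / R) ^ 2) :
    HasFDerivAt f L c := by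
  refine .of_isLittleO (Asymptotics.IsBigO.trans_isLittleO (g := fun w => ‖w - c‖ ^ 2)
    (.of_bound (K / R ^ 2) ?_) (Asymptotics.isLittleO_pow_sub_sub c one_lt_two))
  filter_upwards [ball_mem_nhds c hR] with w hw
  refine (h w hw).trans_eq ?_
  rw [norm_pow, norm_norm]
  ring

/-- The pointwise limit of a uniformly bounded sequence of holomorphic maps is holomorphic: the
quadratic remainder estimate makes the derivatives converge pointwise and passes to the limit. -/
theorem differentiableAt_of_tendsto_of_bounded [CompleteSpace F] {u : ℕ → E → F} (hR : 0 < R)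
    (hd : ∀ n, DifferentiableOn ℂ (u n) (ball c R))
    (hM : ∀ n, ∀ x ∈ ball c R, ‖u n x‖ ≤ M)
    (hu : ∀ x ∈ ball c R, Tendsto (fun n => u n x) atTop (𝓝 (f x))) :
    DifferentiableAt ℂ f c := by
  have hc := mem_ball_self (x := c) hR
  have hM0 : 0 ≤ M := (norm_nonneg _).trans (hM 0 c hc)
  have hbound : ∀ n, ‖fderiv ℂ (u n) c‖ ≤ 2 * M / R := fun n =>
    norm_fderiv_le_of_norm_le hR (hd n) (hM n)
  have hcau : ∀ v, CauchySeq fun n => fderiv ℂ (u n) c v := by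
    intro v
    rw [Metric.cauchySeq_iff']
    intro ε hε
    -- A scale `t` at which the quadratic remainder is negligible against the increment.
    obtain ⟨t, ht0, htR, htε⟩ : ∃ t : ℝ, 0 < t ∧ t * ‖v‖ < R ∧
        8 * M * (‖v‖ / R) ^ 2 * t < ε / 2 := by
      have h1 : Tendsto (fun t : ℝ => t * ‖v‖) (𝓝[>] 0) (𝓝 0) := by
        have : ContinuousAt (fun t : ℝ => t * ‖v‖) 0 := by fun_prop
        simpa using this.tendsto.mono_left nhdsWithin_le_nhds
      have h2 : Tendsto (fun t : ℝ => 8 * M * (‖v‖ / R) ^ 2 * t) (𝓝[>] 0) (𝓝 0) := by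
        have : ContinuousAt (fun t : ℝ => 8 * M * (‖v‖ / R) ^ 2 * t) 0 := by fun_prop
        simpa using this.tendsto.mono_left nhdsWithin_le_nhds
      obtain ⟨t, h⟩ := ((h1.eventually (gt_mem_nhds hR)).and
        ((h2.eventually (gt_mem_nhds (half_pos hε))).and self_mem_nhdsWithin)).exists
      exact ⟨t, h.2.2, h.1, h.2.1⟩
    have hnt : ‖((t : ℂ) • v)‖ = t * ‖v‖ := by
      rw [norm_smul, Complex.norm_real, Real.norm_of_nonneg ht0.le]
    have hx : c + (t : ℂ) • v ∈ ball c R := by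
      rw [mem_ball, dist_eq_norm, add_sub_cancel_left, hnt]
      exact htR
    obtain ⟨N, hN⟩ := Metric.cauchySeq_iff'.1 ((hu _ hx).sub (hu c hc)).cauchySeq
      (t * (ε / 2)) (by positivity)
    refine ⟨N, fun n hn => ?_⟩
    have h1 := hN n hn
    have hq : ∀ k, ‖u k (c + (t : ℂ) • v) - u k c - (t : ℂ) • fderiv ℂ (u k) c v‖ ≤
        4 * M * (t * ‖v‖ / R) ^ 2 := fun k => by
      have := norm_sub_fderiv_le hR (hd k) (hM k) hx
      rwa [add_sub_cancel_left, hnt, map_smul] at this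
    rw [dist_eq_norm] at h1 ⊢
    have h2 : t * ‖fderiv ℂ (u n) c v - fderiv ℂ (u N) c v‖ < t * ε := by
      calc t * ‖fderiv ℂ (u n) c v - fderiv ℂ (u N) c v‖
          = ‖(t : ℂ) • (fderiv ℂ (u n) c v - fderiv ℂ (u N) c v)‖ := by
            rw [norm_smul, Complex.norm_real, Real.norm_of_nonneg ht0.le]
        _ = ‖(u n (c + (t : ℂ) • v) - u n c - (u N (c + (t : ℂ) • v) - u N c))
              - (u n (c + (t : ℂ) • v) - u n c - (t : ℂ) • fderiv ℂ (u n) c v)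
              + (u N (c + (t : ℂ) • v) - u N c - (t : ℂ) • fderiv ℂ (u N) c v)‖ := by
            congr 1; module
        _ < t * (ε / 2) + 4 * M * (t * ‖v‖ / R) ^ 2 + 4 * M * (t * ‖v‖ / R) ^ 2 := by
            refine (norm_add_le _ _).trans_lt (add_lt_add_of_lt_of_le ?_ (hq N))
            exact (norm_sub_le _ _).trans_lt (add_lt_add_of_lt_of_le h1 (hq n))
        _ = t * (ε / 2 + 8 * M * (‖v‖ / R) ^ 2 * t) := by ring
        _ < t * ε := by gcongr; linarith
    exact lt_of_mul_lt_mul_left h2 ht0.le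
  choose D hD using fun v => cauchySeq_tendsto_of_complete (hcau v)
  let L : E →L[ℂ] F := LinearMap.mkContinuous
    { toFun := D
      map_add' := fun v w => tendsto_nhds_unique (hD (v + w)) <| by
        simpa only [map_add] using (hD v).add (hD w)
      map_smul' := fun a v => tendsto_nhds_unique (hD (a • v)) <| by
        simpa only [map_smul, RingHom.id_apply] using (hD v).const_smul a }
    (2 * M / R) fun v => le_of_tendsto (hD v).norm <| Eventually.of_forall fun n =>
      ((fderiv ℂ (u n) c).le_opNorm v).trans (by gcongr; exact hbound n)
  have hL : ∀ w ∈ ball c R, ‖f w - f c - L (w - c)‖ ≤ 4 * M * (‖w - c‖ / R) ^ 2 := by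
    intro w hw
    exact le_of_tendsto (((hu w hw).sub (hu c hc)).sub (hD (w - c))).norm <|
      Eventually.of_forall fun n => norm_sub_fderiv_le hR (hd n) (hM n) hw
  exact (hasFDerivAt_of_norm_sub_le_sq hR hL).differentiableAt

/-- A bounded operator-valued map that is holomorphic in the strong operator sense is holomorphic
in norm. -/
theorem differentiableAt_clm_of_apply {G : Type*} [NormedAddCommGroup G] [NormedSpace ℂ G]
    {T : E → G →L[ℂ] F} (hR : 0 < R) (hd : ∀ v, DifferentiableOn ℂ (fun x => T x v) (ball c R))
    (hM : ∀ x ∈ ball c R, ‖T x‖ ≤ M) : DifferentiableAt ℂ T c := by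
  have hM0 : 0 ≤ M := (norm_nonneg _).trans (hM c (mem_ball_self hR))
  have hda : ∀ v, DifferentiableAt ℂ (fun x => T x v) c := fun v =>
    (hd v).differentiableAt (ball_mem_nhds c hR)
  have hMv : ∀ v, ∀ x ∈ ball c R, ‖T x v‖ ≤ M * ‖v‖ := fun v x hx =>
    ((T x).le_opNorm v).trans (by gcongr; exact hM x hx)
  let L : E →L[ℂ] G →L[ℂ] F := LinearMap.mkContinuous₂
    (LinearMap.mk₂ ℂ (fun h v => fderiv ℂ (fun x => T x v) c h)
      (fun h h' v => map_add _ _ _) (fun a h v => map_smul _ _ _)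
      (fun h v w => by
        simp only [map_add]
        rw [fderiv_fun_add (hda v) (hda w), _root_.add_apply])
      (fun a h v => by
        simp only [map_smul]
        rw [fderiv_fun_const_smul (hda v), _root_.smul_apply]))
    (2 * M / R) fun h v => by
      have := norm_fderiv_le_of_norm_le hR (hd v) (hMv v)
      calc ‖fderiv ℂ (fun x => T x v) c h‖ ≤ 2 * (M * ‖v‖) / R * ‖h‖ :=
            ((fderiv ℂ (fun x => T x v) c).le_opNorm h).trans (by gcongr)
        _ = 2 * M / R * ‖h‖ * ‖v‖ := by ring
  refine (hasFDerivAt_of_norm_sub_le_sq (L := L) (K := 4 * M) hR fun w hw => ?_).differentiableAt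
  refine ContinuousLinearMap.opNorm_le_bound _ (by positivity) fun v => ?_
  calc ‖(T w - T c - L (w - c)) v‖ ≤ 4 * (M * ‖v‖) * (‖w - c‖ / R) ^ 2 :=
        norm_sub_fderiv_le hR (hd v) (hMv v) hw
    _ = _ := by ring

/-- The derivative of a holomorphic map on an open subset of a normed space is holomorphic. -/
theorem DifferentiableOn.fderiv_of_isOpen [CompleteSpace F] {s : Set E}
    (hd : DifferentiableOn ℂ f s) (hs : IsOpen s) : DifferentiableOn ℂ (fderiv ℂ f) s := by
  intro c hcs
  refine DifferentiableAt.differentiableWithinAt ?_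
  -- A ball of radius `4 r` on which `f` is bounded leaves room for three Cauchy estimates.
  obtain ⟨r, hr, hrs, hrM⟩ : ∃ r > 0, ball c (4 * r) ⊆ s ∧
      ∀ x ∈ ball c (4 * r), ‖f x‖ ≤ ‖f c‖ + 1 := by
    have hcont := ((hd c hcs).differentiableAt (hs.mem_nhds hcs)).continuousAt.norm
    obtain ⟨ρ, hρ, h⟩ := Metric.mem_nhds_iff.1 (Filter.inter_mem (hs.mem_nhds hcs)
      (hcont.eventually (gt_mem_nhds (lt_add_one ‖f c‖))))
    refine ⟨ρ / 4, by positivity, ?_⟩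
    rw [mul_div_cancel₀ ρ (by norm_num)]
    exact ⟨fun x hx => (h hx).1, fun x hx => le_of_lt (h hx).2⟩
  set M := ‖f c‖ + 1 with hMdef
  have hM0 : 0 ≤ M := by positivity
  have hdr := hd.mono hrs
  have hsub : ∀ {x y : E} {a b d : ℝ}, x ∈ ball c a → y ∈ ball x b → a + b ≤ d →
      y ∈ ball c d := by
    intro x y a b d hx hy hab
    rw [mem_ball] at *
    linarith [dist_triangle y x c]
  have hlip : ∀ x ∈ ball c (2 * r), ∀ y ∈ ball x r, ‖f y - f x‖ ≤ 2 * M / r * ‖y - x‖ := by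
    intro x hx y hy
    rw [← dist_eq_norm, ← dist_eq_norm]
    refine Complex.dist_le_div_mul_dist_of_mapsTo_ball (hdr.mono fun z hz => hsub hx hz ?_)
      (fun z hz => ?_) hy
    · linarith
    · rw [mem_closedBall, dist_eq_norm]
      have h1 := hrM z (hsub hx hz (by linarith))
      have h2 := hrM x (hsub hx (mem_ball_self hr) (by linarith))
      linarith [norm_sub_le (f z) (f x)]
  have hdiff : ∀ x ∈ ball c (2 * r), DifferentiableAt ℂ f x := fun x hx =>
    hdr.differentiableAt (isOpen_ball.mem_nhds (ball_subset_ball (by linarith) hx))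
  refine differentiableAt_clm_of_apply (R := r) (M := 2 * M / r) hr (fun v x hx => ?_)
    fun x hx => ?_
  · refine DifferentiableAt.differentiableWithinAt ?_
    -- The directional derivative is a bounded pointwise limit of difference quotients.
    obtain ⟨N, hN⟩ := exists_nat_gt (‖v‖ / r)
    have hpos : ∀ n : ℕ, (0 : ℝ) < (n : ℝ) + N + 1 := fun n => by positivity
    set δ : ℕ → ℂ := fun n => ((n : ℂ) + N + 1)⁻¹ with hδ
    have hδn : ∀ n, ‖δ n‖ = ((n : ℝ) + N + 1)⁻¹ := fun n => by
      rw [hδ]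
      simp only [norm_inv]
      rw [← Complex.norm_of_nonneg (hpos n).le]
      push_cast
      rfl
    have hδ0 : ∀ n, δ n ≠ 0 := fun n => by
      rw [← norm_pos_iff, hδn]; exact inv_pos.2 (hpos n)
    have hδv : ∀ n, ‖δ n • v‖ < r := fun n => by
      rw [norm_smul, hδn, inv_mul_lt_iff₀ (hpos n), ← div_lt_iff₀ hr]
      have : (0 : ℝ) ≤ n := n.cast_nonneg
      linarith
    have hδlim : Tendsto (fun n => ‖(δ n)⁻¹‖) atTop atTop := by
      simp only [norm_inv, hδn, inv_inv, add_assoc]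
      exact tendsto_atTop_add_const_right atTop ((N : ℝ) + 1) tendsto_natCast_atTop_atTop
    have hmem : ∀ n, ∀ y ∈ ball x r, y + δ n • v ∈ ball y r := fun n y _ => by
      rw [mem_ball, dist_eq_norm, add_sub_cancel_left]; exact hδv n
    refine differentiableAt_of_tendsto_of_bounded (R := r) (M := 2 * M / r * ‖v‖)
      (u := fun n y => (δ n)⁻¹ • (f (y + δ n • v) - f y)) hr (fun n y hy => ?_)
      (fun n y hy => ?_) (fun y hy => ?_)
    · have hy2 : y ∈ ball c (2 * r) := hsub hx hy (by linarith)
      have h1 : DifferentiableAt ℂ f (y + δ n • v) :=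
        hdr.differentiableAt (isOpen_ball.mem_nhds (hsub hy2 (hmem n y hy) (by linarith)))
      have h2 : DifferentiableAt ℂ (fun y => f (y + δ n • v)) y :=
        h1.comp y (by fun_prop)
      exact ((h2.sub (hdiff y hy2)).const_smul _).differentiableWithinAt
    · have hy2 : y ∈ ball c (2 * r) := hsub hx hy (by linarith)
      have h1 := hlip y hy2 _ (hmem n y hy)
      rw [add_sub_cancel_left, norm_smul] at h1
      rw [norm_smul, norm_inv, inv_mul_le_iff₀ (norm_pos_iff.2 (hδ0 n))]
      linarith
    · have hy2 : y ∈ ball c (2 * r) := hsub hx hy (by linarith)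
      simpa only [inv_inv] using (hdiff y hy2).hasFDerivAt.lim v hδlim
  · have hx2 : x ∈ ball c (2 * r) := ball_subset_ball (by linarith) hx
    refine norm_fderiv_le_of_lip' _ (by positivity) ?_
    filter_upwards [ball_mem_nhds x hr] with y hy using hlip x hx2 y hy

/-- A holomorphic map on an open subset of a normed space is smooth. -/
theorem DifferentiableOn.contDiffOn_of_isOpen_of_normedSpace {E F : Type u}
    [NormedAddCommGroup E] [NormedSpace ℂ E] [NormedAddCommGroup F] [NormedSpace ℂ F]
    [CompleteSpace F] {f : E → F} {s : Set E}
    (hd : DifferentiableOn ℂ f s) (hs : IsOpen s) (n : ℕ) : ContDiffOn ℂ n f s := by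
  induction n generalizing F with
  | zero => exact contDiffOn_zero.2 hd.continuousOn
  | succ n ih =>
    rw [Nat.cast_add, Nat.cast_one, contDiffOn_succ_iff_fderiv_of_isOpen hs]
    exact ⟨hd, fun h => by simp at h, ih (DifferentiableOn.fderiv_of_isOpen hd hs)⟩

/-- The `m`-th derivative at `0`, evaluated on the diagonal, is the `m`-th derivative along the
complex line. -/
theorem iteratedFDeriv_apply_diag {E : Type} [NormedAddCommGroup E] [NormedSpace ℂ E]
    {f : E → ℂ} (hR : 0 < R) (hd : DifferentiableOn ℂ f (ball 0 R)) (x : E) (m : ℕ) :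
    iteratedFDeriv ℂ m f 0 (fun _ => x) = iteratedDeriv m (fun t : ℂ => f (t • x)) 0 := by
  set g : ℂ →L[ℂ] E := ContinuousLinearMap.toSpanSingleton ℂ x with hg
  have hcd := DifferentiableOn.contDiffOn_of_isOpen_of_normedSpace hd isOpen_ball m
  have ho : IsOpen (g ⁻¹' ball 0 R) := isOpen_ball.preimage g.continuous
  have h0 : g 0 ∈ ball (0 : E) R := by rw [map_zero]; exact mem_ball_self hR
  have h := g.iteratedFDerivWithin_comp_right hcd isOpen_ball.uniqueDiffOn ho.uniqueDiffOn h0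
    le_rfl
  rw [iteratedFDerivWithin_of_isOpen m ho h0, iteratedFDerivWithin_of_isOpen m isOpen_ball h0,
    map_zero] at h
  rw [iteratedDeriv_eq_iteratedFDeriv]
  have h2 := congrArg (fun A => A fun _ => (1 : ℂ)) h
  simp only [ContinuousMultilinearMap.compContinuousLinearMap_apply, hg,
    ContinuousLinearMap.toSpanSingleton_apply, one_smul] at h2
  exact h2.symm

theorem differentiableOn_line {E : Type} [NormedAddCommGroup E] [NormedSpace ℂ E]
    {f : E → ℂ} (hd : DifferentiableOn ℂ f (ball 0 1)) {x : E} {r : ℝ} (hx : ‖x‖ * r ≤ 1) :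
    DifferentiableOn ℂ (fun t : ℂ => f (t • x)) (ball 0 r) := by
  refine hd.comp (f := fun t : ℂ => t • x) (by fun_prop) fun t ht => ?_
  rw [mem_ball_zero_iff] at ht ⊢
  rw [norm_smul]
  rcases eq_or_ne x 0 with rfl | hx0
  · simp
  · have := norm_pos_iff.2 hx0
    nlinarith

/-- The Taylor series at `0` of a holomorphic function on the unit ball. -/
theorem hasSum_taylor_diag {E : Type} [NormedAddCommGroup E] [NormedSpace ℂ E]
    {f : E → ℂ} (hd : DifferentiableOn ℂ f (ball 0 1)) {x : E} (hx : ‖x‖ < 1) :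
    HasSum (fun m : ℕ => (m.factorial : ℂ)⁻¹ * iteratedFDeriv ℂ m f 0 (fun _ => x)) (f x) := by
  obtain ⟨r, hr1, hxr⟩ : ∃ r : ℝ, 1 < r ∧ ‖x‖ * r ≤ 1 := by
    refine ⟨2 / (1 + ‖x‖), ?_, ?_⟩
    · rw [lt_div_iff₀ (by positivity)]; linarith
    · rw [← mul_div_assoc, div_le_one (by positivity)]; linarith
  have h := Complex.hasSum_taylorSeries_on_ball (z := 1) (differentiableOn_line hd hxr)
    (by rw [mem_ball_zero_iff, norm_one]; exact hr1)
  simp only [iteratedFDeriv_apply_diag one_pos hd x]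
  simpa using h

/-- Cauchy estimates for the homogeneous Taylor terms at `0`, with the sharp rate `‖x‖ ^ m`. -/
theorem norm_taylor_diag_le {E : Type} [NormedAddCommGroup E] [NormedSpace ℂ E]
    {f : E → ℂ} {M : ℝ} (hd : DifferentiableOn ℂ f (ball 0 1)) (hM : ∀ x ∈ ball 0 1, ‖f x‖ ≤ M)
    {x : E} {ρ : ℝ} (hx : ‖x‖ ≤ ρ) (hρ0 : 0 < ρ) (hρ : ρ < 1) (m : ℕ) :
    ‖(m.factorial : ℂ)⁻¹ * iteratedFDeriv ℂ m f 0 (fun _ => x)‖ ≤ M * ρ ^ m := by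
  rw [iteratedFDeriv_apply_diag one_pos hd x, norm_mul, norm_inv, Complex.norm_natCast]
  have key : ∀ s : ℝ, ρ < s → s < 1 →
      ((m.factorial : ℝ))⁻¹ * ‖iteratedDeriv m (fun t : ℂ => f (t • x)) 0‖ ≤ M * s ^ m := by
    intro s hs hs1
    have hs0 : 0 < s := hρ0.trans hs
    have hsub : ∀ t : ℂ, ‖t‖ ≤ s⁻¹ → t • x ∈ ball (0 : E) 1 := fun t ht => by
      rw [mem_ball_zero_iff, norm_smul]
      calc ‖t‖ * ‖x‖ ≤ s⁻¹ * ρ := by gcongr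
        _ < s⁻¹ * s := by gcongr
        _ = 1 := inv_mul_cancel₀ hs0.ne'
    have hdc : DiffContOnCl ℂ (fun t : ℂ => f (t • x)) (ball 0 s⁻¹) := by
      refine DifferentiableOn.diffContOnCl ?_
      rw [closure_ball _ (inv_pos.2 hs0).ne']
      exact hd.comp (f := fun t : ℂ => t • x) (by fun_prop) fun t ht =>
        hsub t (mem_closedBall_zero_iff.1 ht)
    have h := Complex.norm_iteratedDeriv_le_of_forall_mem_sphere_norm_le m (inv_pos.2 hs0) hdc
      (C := M) fun t ht => hM _ (hsub t (mem_sphere_zero_iff_norm.1 ht).le)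
    rw [inv_mul_le_iff₀ (by positivity)]
    refine h.trans_eq ?_
    rw [inv_pow]
    field_simp
  have hlim : Tendsto (fun s : ℝ => M * s ^ m) (𝓝[>] ρ) (𝓝 (M * ρ ^ m)) := by
    have : ContinuousAt (fun s : ℝ => M * s ^ m) ρ := by fun_prop
    exact this.tendsto.mono_left nhdsWithin_le_nhds
  refine ge_of_tendsto hlim ?_
  filter_upwards [Ioo_mem_nhdsGT hρ] with s hs using key s hs.1 hs.2

end BanachHolomorphy

/-! ### Truncations of elements of the bidual of `c₀` -/

/-- The dual of a complex normed space. On `c₀` the module structure is then the one underlying the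
normed space structure. -/
abbrev Dual (E : Type*) [NormedAddCommGroup E] [NormedSpace ℂ E] : Type _ := StrongDual ℂ E

/-- The bidual of a complex normed space. -/
abbrev Bidual (E : Type*) [NormedAddCommGroup E] [NormedSpace ℂ E] : Type _ :=
  StrongDual ℂ (StrongDual ℂ E)

theorem c0_norm_le {x : c0} {C : ℝ} (hC : 0 ≤ C) (h : ∀ i, ‖x i‖ ≤ C) : ‖x‖ ≤ C := by
  rw [← ZeroAtInftyContinuousMap.norm_toBCF_eq_norm, BoundedContinuousFunction.norm_le hC]
  exact h

theorem c0_norm_apply_le (x : c0) (i : ℕ) : ‖x i‖ ≤ ‖x‖ := by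
  rw [← ZeroAtInftyContinuousMap.norm_toBCF_eq_norm]
  exact x.toBCF.norm_coe_le_norm i

theorem c0OfFinset_apply (s : Finset ℕ) (a : ℕ → ℂ) (i : ℕ) :
    c0OfFinset s a i = if i ∈ s then a i else 0 := rfl

theorem tendsto_c0OfFinset_range (x : c0) :
    Tendsto (fun N => c0OfFinset (Finset.range N) x) atTop (𝓝 x) := by
  have hx : Tendsto x atTop (𝓝 0) := by
    have := x.zero_at_infty'
    rwa [Filter.cocompact_eq_cofinite, Nat.cofinite_eq_atTop] at this
  rw [Metric.tendsto_atTop] at hx ⊢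
  intro ε hε
  obtain ⟨N, hN⟩ := hx (ε / 2) (half_pos hε)
  refine ⟨N, fun n hn => ?_⟩
  rw [dist_eq_norm]
  refine (c0_norm_le (half_pos hε).le fun i => ?_).trans_lt (half_lt_self hε)
  rw [ZeroAtInftyContinuousMap.sub_apply, c0OfFinset_apply]
  split_ifs with hi
  · simpa using (half_pos hε).le
  · have : N ≤ i := by
      rw [Finset.mem_range] at hi
      omega
    simpa using (hN i this).le

/-- The `i`-th coordinate functional on `c₀`. -/
def coord (i : ℕ) : Dual c0 :=
  LinearMap.mkContinuous
    { toFun := fun x => x i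
      map_add' := fun _ _ => rfl
      map_smul' := fun _ _ => rfl } 1 fun x => by
    rw [one_mul]
    exact c0_norm_apply_le x i

@[simp]
theorem coord_apply (i : ℕ) (x : c0) : coord i x = x i := rfl

theorem norm_coord_le (i : ℕ) : ‖coord i‖ ≤ 1 :=
  LinearMap.mkContinuous_norm_le _ zero_le_one _

/-- Every functional on `c₀` is the norm-convergent combination of coordinate functionals given by
its values on the unit vectors. -/
theorem hasSum_coord (φ : Dual c0) :
    HasSum (fun i => φ (unitVec i) • coord i) φ := by
  have hs : Summable fun i => φ (unitVec i) • coord i := by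
    refine Summable.of_norm_bounded (summable_norm_unitVec φ) fun i => ?_
    rw [norm_smul]
    exact mul_le_of_le_one_right (norm_nonneg _) (norm_coord_le i)
  convert hs.hasSum
  ext x
  have h1 := (hs.hasSum.mapL (ContinuousLinearMap.apply ℂ ℂ x)).tendsto_sum_nat
  refine tendsto_nhds_unique ?_ h1
  have h2 := (φ.continuous.tendsto x).comp (tendsto_c0OfFinset_range x)
  refine h2.congr fun N => ?_
  rw [Function.comp_apply, c0OfFinset_eq_sum, map_sum]
  refine Finset.sum_congr rfl fun i _ => ?_
  simp [mul_comm]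

theorem norm_le_tsum_unitVec (φ : Dual c0) : ‖φ‖ ≤ ∑' i, ‖φ (unitVec i)‖ := by
  refine (hasSum_coord φ).norm_le_of_bounded (summable_norm_unitVec φ).hasSum fun i => ?_
  rw [norm_smul]
  exact mul_le_of_le_one_right (norm_nonneg _) (norm_coord_le i)

/-- The `N`-th truncation: an element of the bidual of `c₀`, seen as a bounded sequence, is cut off
to its first `N` coordinates. -/
def trunc (N : ℕ) : Bidual c0 →L[ℂ] c0 :=
  ∑ i ∈ Finset.range N, (ContinuousLinearMap.apply ℂ ℂ (coord i)).smulRight (unitVec i)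

theorem trunc_eq (N : ℕ) (ζ : Bidual c0) :
    trunc N ζ = c0OfFinset (Finset.range N) fun i => ζ (coord i) := by
  rw [c0OfFinset_eq_sum, trunc, _root_.sum_apply]
  rfl

theorem norm_trunc_le (N : ℕ) (ζ : Bidual c0) : ‖trunc N ζ‖ ≤ ‖ζ‖ := by
  rw [trunc_eq]
  refine c0_norm_le ζ.opNorm_nonneg fun i => ?_
  rw [c0OfFinset_apply]
  split_ifs
  · exact (ζ.le_opNorm _).trans (mul_le_of_le_one_right (norm_nonneg _) (norm_coord_le i))
  · rw [norm_zero]; exact ζ.opNorm_nonneg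

/-- The truncations of `ζ` converge to `ζ` in the weak-star topology. -/
theorem tendsto_trunc (ζ : Bidual c0) (φ : Dual c0) :
    Tendsto (fun N => φ (trunc N ζ)) atTop (𝓝 (ζ φ)) := by
  have h := ((hasSum_coord φ).mapL ζ).tendsto_sum_nat
  refine h.congr fun N => ?_
  rw [trunc_eq, c0OfFinset_eq_sum, map_sum]
  refine Finset.sum_congr rfl fun i _ => ?_
  simp [mul_comm]

/-! ### The Schur property of the dual of `c₀` -/

/-- The pairing of a functional on `c₀` with a sequence in the closed unit disc. -/
def discPairing (φ : Dual c0) (z : ℕ → closedBall (0 : ℂ) 1) : ℂ :=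
  ∑' i, φ (unitVec i) * (z i : ℂ)

theorem norm_unitVec_mul_le (φ : Dual c0) (z : ℕ → closedBall (0 : ℂ) 1) (i : ℕ) :
    ‖φ (unitVec i) * (z i : ℂ)‖ ≤ ‖φ (unitVec i)‖ := by
  rw [norm_mul]
  exact mul_le_of_le_one_right (norm_nonneg _) (mem_closedBall_zero_iff.1 (z i).2)

theorem continuous_discPairing (φ : Dual c0) : Continuous (discPairing φ) :=
  continuous_tsum (fun i => by fun_prop) (summable_norm_unitVec φ)
    fun i z => norm_unitVec_mul_le φ z i

/-- The pairing with a fixed sequence in the closed unit disc is an element of the bidual. -/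
theorem exists_bidual_eq_discPairing (z : ℕ → closedBall (0 : ℂ) 1) :
    ∃ ζ : Bidual c0, ∀ φ, ζ φ = discPairing φ z := by
  have hz : Memℓp (fun i => (z i : ℂ)) ∞ := memℓp_infty
    ⟨1, by rintro _ ⟨i, rfl⟩; exact mem_closedBall_zero_iff.1 (z i).2⟩
  exact ⟨toBidual ⟨_, hz⟩, fun φ => rfl⟩

/-- A functional is controlled in norm by finitely many of its coordinates and by its pairings with
the sequences whose entries at those coordinates are prescribed. -/
theorem norm_le_of_discPairing_le (ψ : Dual c0) (I : Finset ℕ)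
    (z₀ : ℕ → closedBall (0 : ℂ) 1) {ε : ℝ}
    (h : ∀ z : ℕ → closedBall (0 : ℂ) 1, (∀ i ∈ I, z i = z₀ i) → ‖discPairing ψ z‖ ≤ ε) :
    ‖ψ‖ ≤ ε + 2 * ∑ i ∈ I, ‖ψ (unitVec i)‖ := by
  classical
  -- Off `I`, the entries of `w` rotate the values of `ψ` to the positive axis.
  let w : ℕ → closedBall (0 : ℂ) 1 := fun i => if i ∈ I then z₀ i else
    ⟨(starRingEnd ℂ) (ψ (unitVec i)) / ‖ψ (unitVec i)‖, by
      rw [mem_closedBall_zero_iff, norm_div, RCLike.norm_conj, Complex.norm_real, norm_norm]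
      exact div_self_le_one _⟩
  have hw : ∀ i, ((‖ψ (unitVec i)‖ : ℝ) : ℂ) = ψ (unitVec i) * (w i : ℂ) +
      if i ∈ I then ((‖ψ (unitVec i)‖ : ℝ) : ℂ) - ψ (unitVec i) * (z₀ i : ℂ) else 0 := by
    intro i
    by_cases hi : i ∈ I
    · simp [w, hi]
    · simp only [w, hi, if_false, add_zero]
      by_cases h0 : ψ (unitVec i) = 0
      · simp [h0]
      · have : ((‖ψ (unitVec i)‖ : ℝ) : ℂ) ≠ 0 := by simpa using h0
        rw [mul_div_assoc', Complex.mul_conj', sq, mul_div_assoc, div_self this, mul_one]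
  have hsum : ((∑' i, ‖ψ (unitVec i)‖ : ℝ) : ℂ) = discPairing ψ w +
      ∑ i ∈ I, (((‖ψ (unitVec i)‖ : ℝ) : ℂ) - ψ (unitVec i) * (z₀ i : ℂ)) := by
    rw [Complex.ofReal_tsum, tsum_congr hw, Summable.tsum_add]
    · rw [discPairing, tsum_eq_sum (s := I) (fun i hi => if_neg hi)]
      congr 1
      exact Finset.sum_congr rfl fun i hi => if_pos hi
    · exact Summable.of_norm_bounded (summable_norm_unitVec ψ) (norm_unitVec_mul_le ψ w)
    · exact summable_of_ne_finset_zero (s := I) fun i hi => by simp [hi]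
  have hn := congrArg norm hsum
  rw [Complex.norm_real, Real.norm_of_nonneg (tsum_nonneg fun _ => norm_nonneg _)] at hn
  refine (norm_le_tsum_unitVec ψ).trans ?_
  rw [hn, Finset.mul_sum]
  refine (norm_add_le _ _).trans (add_le_add (h w fun i hi => by simp [w, hi]) ?_)
  refine (norm_sum_le _ _).trans (Finset.sum_le_sum fun i _ => ?_)
  refine (norm_sub_le _ _).trans ?_
  rw [Complex.norm_real, norm_norm, two_mul]
  gcongr
  exact norm_unitVec_mul_le ψ z₀ i

/-- **Schur's theorem** for `c₀* = ℓ₁`: weakly Cauchy sequences are norm Cauchy. The Baire category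
theorem in the compact space of sequences in the closed unit disc makes the weak Cauchy condition
uniform on a basic open set. -/
theorem cauchySeq_of_weakly_cauchySeq {φ : ℕ → Dual c0}
    (h : ∀ ζ : Bidual c0, CauchySeq fun n => ζ (φ n)) : CauchySeq φ := by
  rw [Metric.cauchySeq_iff]
  intro ε hε
  let K : ℕ → Set (ℕ → closedBall (0 : ℂ) 1) := fun N =>
    {z | ∀ n ≥ N, ∀ m ≥ N, ‖discPairing (φ n - φ m) z‖ ≤ ε / 4}
  have hK : ∀ N, IsClosed (K N) := fun N => by
    simp only [K, ofPred_forall]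
    exact isClosed_iInter fun n => isClosed_iInter fun _ => isClosed_iInter fun m =>
      isClosed_iInter fun _ =>
        isClosed_le (continuous_discPairing (φ n - φ m)).norm continuous_const
  have hU : ⋃ N, K N = univ := by
    refine eq_univ_of_forall fun z => ?_
    obtain ⟨ζ, hζ⟩ := exists_bidual_eq_discPairing z
    obtain ⟨N, hN⟩ := Metric.cauchySeq_iff.1 (h ζ) (ε / 4) (by positivity)
    refine mem_iUnion.2 ⟨N, fun n hn m hm => ?_⟩
    rw [← hζ, map_sub, ← dist_eq_norm]
    exact (hN n hn m hm).le
  obtain ⟨N, z₀, hz₀⟩ := nonempty_interior_of_iUnion_of_closed hK hU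
  obtain ⟨I, u, hu, hIu⟩ := isOpen_pi_iff.1 isOpen_interior z₀ hz₀
  have hcoord : CauchySeq fun n => fun i : I => φ n (unitVec i) := by
    have := fun i : I => cauchySeq_tendsto_of_complete
      (h (ContinuousLinearMap.apply ℂ ℂ (unitVec i)))
    choose l hl using this
    exact (tendsto_pi_nhds.2 hl).cauchySeq
  obtain ⟨N', hN'⟩ := Metric.cauchySeq_iff.1 hcoord (ε / (4 * (I.card + 1))) (by positivity)
  refine ⟨max N N', fun n hn m hm => ?_⟩
  rw [ge_iff_le, max_le_iff] at hn hm
  rw [dist_eq_norm]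
  have h1 := norm_le_of_discPairing_le (φ n - φ m) I z₀ (ε := ε / 4) fun z hz =>
    interior_subset (hIu (fun i hi => by rw [hz i hi]; exact (hu i hi).2)) n hn.1 m hm.1
  have h2 : ∑ i ∈ I, ‖(φ n - φ m) (unitVec i)‖ ≤ I.card * (ε / (4 * (I.card + 1))) := by
    rw [← nsmul_eq_mul]
    refine Finset.sum_le_card_nsmul _ _ _ fun i hi => ?_
    rw [_root_.sub_apply, ← dist_eq_norm]
    exact (dist_le_pi_dist (fun i : I => φ n (unitVec i)) (fun i : I => φ m (unitVec i))
      ⟨i, hi⟩).trans (hN' n hn.2 m hm.2).le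
  have h3 : (I.card : ℝ) * (ε / (4 * (I.card + 1))) ≤ ε / 4 := by
    rw [← mul_div_assoc, div_le_div_iff₀ (by positivity) (by norm_num)]
    nlinarith
  linarith

/-! ### The Arens extension as a limit along truncations -/

/-- On `c₀` the iterated weak-star limit defining the Arens extension on the diagonal is a simple
limit along the truncations. With all but the first argument of `A` truncated, one obtains a
sequence in `c₀*` which is weakly Cauchy by the induction hypothesis, hence norm convergent by
Schur's theorem. -/
theorem tendsto_apply_trunc (ζ : Bidual c0) (m : ℕ)
    (A : c0 [×m]→L[ℂ] ℂ) :
    Tendsto (fun N => A fun _ => trunc N ζ) atTop (𝓝 (arensEval ζ m A)) := by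
  induction m with
  | zero =>
    refine tendsto_const_nhds.congr fun N => ?_
    change A 0 = _
    congr 1
    exact Subsingleton.elim _ _
  | succ m ih =>
    set T : c0 →L[ℂ] (c0 [×m]→L[ℂ] ℂ) := A.curryLeft
    -- `φ N` fixes all arguments of `A` but the first; `φ'` is its pointwise limit.
    let φ : ℕ → Dual c0 := fun N =>
      (ContinuousMultilinearMap.apply ℂ (fun _ : Fin m => c0) ℂ fun _ => trunc N ζ) ∘L T
    let φ' : Dual c0 := arensEval ζ m ∘L T
    have hval : arensEval ζ (m + 1) A = ζ φ' := rfl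
    have hweak : ∀ η : Bidual c0, CauchySeq fun N => η (φ N) := by
      intro η
      -- Pairing the first argument of `A` with `η` leaves a form of degree `m`.
      let B : c0 [×m]→L[ℂ] ℂ := η.compContinuousMultilinearMap T.flipMultilinear
      exact (ih B).cauchySeq
    obtain ⟨ψ, hψ⟩ := cauchySeq_tendsto_of_complete (cauchySeq_of_weakly_cauchySeq hweak)
    have hψφ : ψ = φ' := by
      ext x
      have h1 := ((ContinuousLinearMap.apply ℂ ℂ x).continuous.tendsto ψ).comp hψ
      exact tendsto_nhds_unique h1 (ih (T x))
    rw [hψφ] at hψ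
    have hdiff : Tendsto (fun N => (φ N - φ') (trunc N ζ)) atTop (𝓝 0) := by
      have h0 : Tendsto (fun N => ‖φ N - φ'‖ * ‖ζ‖) atTop (𝓝 0) := by
        simpa using (tendsto_iff_norm_sub_tendsto_zero.1 hψ).mul_const ‖ζ‖
      refine squeeze_zero_norm (fun N => ?_) h0
      exact ((φ N - φ').le_opNorm _).trans (by gcongr; exact norm_trunc_le N ζ)
    have hsum := hdiff.add (tendsto_trunc ζ φ')
    rw [zero_add, ← hval] at hsum
    refine hsum.congr fun N => ?_
    rw [_root_.sub_apply, sub_add_cancel]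
    change A (Fin.cons (trunc N ζ) fun _ => trunc N ζ) = _
    congr 1
    ext i : 1
    refine Fin.cases rfl (fun _ => rfl) i

/-! ### Elementary facts on dual spaces -/

section Dual

-- These facts are stated for the dual of an abstract space, so that they elaborate without
-- unfolding the instances on an iterated dual.
variable {X : Type*} [NormedAddCommGroup X] [NormedSpace ℂ X]

theorem dual_norm_smul (a : ℂ) (ζ : Dual X) : ‖a • ζ‖ = ‖a‖ * ‖ζ‖ := norm_smul a ζ

theorem dual_mem_ball_iff {ζ : Dual X} : ζ ∈ ball (0 : Dual X) 1 ↔ ‖ζ‖ < 1 := mem_ball_zero_iff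

theorem dual_mem_closure_ball {ζ : Dual X} (hζ : ‖ζ‖ ≤ 1) : ζ ∈ closure (ball (0 : Dual X) 1) := by
  rw [closure_ball _ one_ne_zero]
  exact mem_closedBall_zero_iff.2 hζ

theorem dual_add_zero_smul (ζ κ : Dual X) : ζ + (0 : ℂ) • κ = ζ := by
  ext φ
  simp

theorem dual_norm_sub_lt {a b ζ : Dual X} {δ : ℝ} (ha : a ∈ ball ζ (δ / 2))
    (hb : b ∈ ball ζ (δ / 2)) : ‖a - b‖ < δ := by
  rw [← dist_eq_norm]
  rw [mem_ball] at ha hb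
  linarith [dist_triangle_right a b ζ]

variable {F : Type*} [NormedAddCommGroup F] [NormedSpace ℂ F]

theorem differentiable_clm_dual_line (L : Dual X →L[ℂ] F) (ζ κ : Dual X) :
    Differentiable ℂ fun t : ℂ => L (ζ + t • κ) :=
  L.differentiable.comp (by fun_prop)

theorem differentiableOn_clm_comp_dual {D : Type*} [NormedAddCommGroup D] [NormedSpace ℂ D]
    (L : Dual X →L[ℂ] F) {Z : D → Dual X} {s : Set D} (hZ : DifferentiableOn ℂ Z s) :
    DifferentiableOn ℂ (fun x => L (Z x)) s :=
  L.differentiable.comp_differentiableOn hZ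

theorem differentiableOn_dual_clm_comp {D : Type*} [NormedAddCommGroup D] [NormedSpace ℂ D]
    (L : F →L[ℂ] Dual X) {Z : D → F} {s : Set D} (hZ : DifferentiableOn ℂ Z s) :
    DifferentiableOn ℂ (fun x => L (Z x)) s :=
  L.differentiable.comp_differentiableOn hZ

end Dual

/-! ### The canonical extension as a limit of values on the ball -/

section Approximation

variable {E : Type} [NormedAddCommGroup E] [NormedSpace ℂ E]

/-- A sequence of contractions from the bidual of `E` to `E` along which the diagonal values of the
Arens extension of every continuous multilinear form are limits of values of the form itself. -/
structure IsArensApproximation (T : ℕ → Bidual E →L[ℂ] E) : Prop where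
  norm_le : ∀ N ζ, ‖T N ζ‖ ≤ ‖ζ‖
  tendsto_apply : ∀ (ζ : Bidual E) (m : ℕ) (A : E [×m]→L[ℂ] ℂ),
    Tendsto (fun N => A fun _ => T N ζ) atTop (𝓝 (arensEval ζ m A))

variable {T : ℕ → Bidual E →L[ℂ] E}

/-- For a bounded holomorphic function, the Aron–Berner extension at a point of the open ball of
the bidual is the limit of the values at its truncations; the Cauchy estimates dominate the Taylor
series along the truncations. -/
theorem tendsto_aronBerner (hT : IsArensApproximation T) {f : ball (0 : E) 1 → ℂ}
    (hf : IsHolomorphic f) {M : ℝ}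
    (hM : ∀ x, ‖f x‖ ≤ M) {ζ : Bidual E} (hζ : ‖ζ‖ < 1) :
    Tendsto (fun N => extendZero f (T N ζ)) atTop (𝓝 (aronBerner f ζ)) := by
  have hM' : ∀ x ∈ ball (0 : E) 1, ‖extendZero f x‖ ≤ M := fun x hx => by
    rw [extendZero_apply f hx]
    exact hM _
  obtain ⟨ρ, hρ, hρ1⟩ := exists_between hζ
  have hρ0 : 0 < ρ := ζ.opNorm_nonneg.trans_lt hρ
  have hlim := tendsto_tsum_of_dominated_convergence (bound := fun m : ℕ => M * ρ ^ m)
    (f := fun (N : ℕ) (m : ℕ) => (m.factorial : ℂ)⁻¹ *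
      iteratedFDeriv ℂ m (extendZero f) 0 (fun _ => T N ζ))
    (g := fun m : ℕ => (m.factorial : ℂ)⁻¹ * arensEval ζ m (iteratedFDeriv ℂ m (extendZero f) 0))
    (𝓕 := atTop)
    ((summable_geometric_of_lt_one hρ0.le hρ1).mul_left M)
    (fun m => (hT.tendsto_apply ζ m _).const_mul _)
    (Eventually.of_forall fun N m =>
      norm_taylor_diag_le hf hM' ((hT.norm_le N ζ).trans hρ.le) hρ0 hρ1 m)
  refine hlim.congr fun N => ?_
  exact (hasSum_taylor_diag hf ((hT.norm_le N ζ).trans_lt hζ)).tsum_eq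

theorem exists_delta_of_uniformContinuous {f : ball (0 : E) 1 → ℂ} (hu : UniformContinuous f)
    {ε : ℝ} (hε : 0 < ε) : ∃ δ > 0, ∀ x ∈ ball (0 : E) 1, ∀ y ∈ ball (0 : E) 1,
      ‖x - y‖ < δ → ‖extendZero f x - extendZero f y‖ < ε := by
  obtain ⟨δ, hδ, h⟩ := Metric.uniformContinuous_iff.1 hu ε hε
  refine ⟨δ, hδ, fun x hx y hy hxy => ?_⟩
  rw [extendZero_apply f hx, extendZero_apply f hy, ← dist_eq_norm]
  exact h (a := ⟨x, hx⟩) (b := ⟨y, hy⟩) (by rwa [Subtype.dist_eq, dist_eq_norm])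

/-- The Aron–Berner extension of a uniformly continuous holomorphic function has limits at all
points of the closed ball of the bidual, so `canonicalExtension` is genuinely a limit. -/
theorem tendsto_aronBerner_canonicalExtension (hT : IsArensApproximation T)
    {f : ball (0 : E) 1 → ℂ} (hf : IsHolomorphic f)
    (hu : UniformContinuous f) {M : ℝ} (hM : ∀ x, ‖f x‖ ≤ M) {ζ : Bidual E} (hζ : ‖ζ‖ ≤ 1) :
    Tendsto (aronBerner f) (𝓝[ball 0 1] ζ) (𝓝 (canonicalExtension f ζ)) := by
  have hcl : ζ ∈ closure (ball (0 : Bidual E) 1) :=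
    dual_mem_closure_ball hζ
  have hne : (𝓝[ball 0 1] ζ).NeBot := mem_closure_iff_nhdsWithin_neBot.1 hcl
  have hcau : Cauchy (map (aronBerner f) (𝓝[ball 0 1] ζ)) := by
    rw [Metric.cauchy_iff]
    refine ⟨hne.map _, fun ε hε => ?_⟩
    obtain ⟨δ, hδ, h⟩ := exists_delta_of_uniformContinuous hu (half_pos hε)
    refine ⟨aronBerner f '' (ball ζ (δ / 2) ∩ ball 0 1), image_mem_map
      (inter_mem (mem_nhdsWithin_of_mem_nhds (ball_mem_nhds ζ (half_pos hδ)))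
        self_mem_nhdsWithin), ?_⟩
    rintro _ ⟨a, ⟨ha, ha1⟩, rfl⟩ _ ⟨b, ⟨hb, hb1⟩, rfl⟩
    replace ha1 := dual_mem_ball_iff.1 ha1
    replace hb1 := dual_mem_ball_iff.1 hb1
    rw [dist_eq_norm]
    have hab : ‖a - b‖ < δ := dual_norm_sub_lt ha hb
    refine lt_of_le_of_lt (le_of_tendsto ((tendsto_aronBerner hT hf hM ha1).sub
      (tendsto_aronBerner hT hf hM hb1)).norm (Eventually.of_forall fun N => ?_)) (half_lt_self hε)
    refine (h _ ?_ _ ?_ ?_).le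
    · exact mem_ball_zero_iff.2 ((hT.norm_le N a).trans_lt ha1)
    · exact mem_ball_zero_iff.2 ((hT.norm_le N b).trans_lt hb1)
    · rw [← map_sub]
      exact (hT.norm_le N _).trans_lt hab
  obtain ⟨l, hl⟩ := cauchy_map_iff_exists_tendsto.1 hcau
  rwa [canonicalExtension, extendFrom_eq hcl hl]

/-- A sequence of radii in `(0, 1)` increasing to `1`. -/
def radius (N : ℕ) : ℝ := 1 - 1 / ((N : ℝ) + 2)

theorem radius_pos (N : ℕ) : 0 < radius N := by
  have : (1 : ℝ) / ((N : ℝ) + 2) < 1 := by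
    rw [div_lt_one (by positivity)]
    linarith [(N.cast_nonneg : (0 : ℝ) ≤ N)]
  rw [radius]
  linarith

theorem radius_lt_one (N : ℕ) : radius N < 1 := by
  have : (0 : ℝ) < 1 / ((N : ℝ) + 2) := by positivity
  rw [radius]
  linarith

theorem tendsto_radius : Tendsto radius atTop (𝓝 1) := by
  have h : Tendsto (fun N : ℕ => 1 / ((N : ℝ) + 2)) atTop (𝓝 0) := by
    simp only [one_div]
    exact tendsto_inv_atTop_zero.comp
      (tendsto_atTop_add_const_right atTop 2 tendsto_natCast_atTop_atTop)
  have h1 := h.const_sub 1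
  rwa [sub_zero] at h1

/-- Truncation followed by contraction; it maps the closed ball of the bidual into the open ball of
`E`. -/
def shrink (T : ℕ → Bidual E →L[ℂ] E) (N : ℕ) : Bidual E →L[ℂ] E := (radius N : ℂ) • T N

theorem shrink_apply (T : ℕ → Bidual E →L[ℂ] E) (N : ℕ) (ζ : Bidual E) :
    shrink T N ζ = (radius N : ℂ) • T N ζ := rfl

theorem norm_radius (N : ℕ) : ‖(radius N : ℂ)‖ = radius N := by
  rw [Complex.norm_real, Real.norm_of_nonneg (radius_pos N).le]

theorem shrink_mem (hT : IsArensApproximation T) (N : ℕ) {ζ : Bidual E} (hζ : ‖ζ‖ ≤ 1) :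
    shrink T N ζ ∈ ball (0 : E) 1 := by
  rw [mem_ball_zero_iff, shrink_apply, norm_smul, norm_radius]
  calc radius N * ‖T N ζ‖ ≤ radius N * 1 := by
        gcongr
        · exact (radius_pos N).le
        · exact (hT.norm_le N ζ).trans hζ
    _ < 1 := by rw [mul_one]; exact radius_lt_one N

/-- The canonical extension is a sequential limit of values on the open ball of `E`, at every
point of the closed ball of the bidual. -/
theorem tendsto_canonicalExtension (hT : IsArensApproximation T) (f : AU E) {ζ : Bidual E}
    (hζ : ‖ζ‖ ≤ 1) :
    Tendsto (fun N => (f : ball (0 : E) 1 →ᵇ ℂ) ⟨shrink T N ζ, shrink_mem hT N hζ⟩) atTop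
      (𝓝 (canonicalExtension (f : ball (0 : E) 1 →ᵇ ℂ) ζ)) := by
  obtain ⟨f, hf, hu⟩ := f
  have hM := f.norm_coe_le_norm
  have hmem : ∀ k, ‖(radius k : ℂ) • ζ‖ < 1 := fun k => by
    rw [dual_norm_smul, norm_radius]
    have := radius_pos k
    have := radius_lt_one k
    nlinarith [ζ.opNorm_nonneg]
  have hrad : Tendsto (fun k => (radius k : ℂ) • ζ) atTop (𝓝[ball 0 1] ζ) := by
    refine tendsto_nhdsWithin_iff.2 ⟨?_, Eventually.of_forall fun k =>
      dual_mem_ball_iff.2 (hmem k)⟩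
    have h : Tendsto (fun k => (radius k : ℂ)) atTop (𝓝 1) := by
      exact_mod_cast (Complex.continuous_ofReal.tendsto 1).comp tendsto_radius
    simpa using h.smul_const ζ
  have hce := (tendsto_aronBerner_canonicalExtension hT hf hu hM hζ).comp hrad
  rw [Metric.tendsto_atTop] at hce ⊢
  intro ε hε
  obtain ⟨δ, hδ, h⟩ := exists_delta_of_uniformContinuous hu (ε := ε / 3) (by positivity)
  obtain ⟨k₁, hk₁⟩ := hce (ε / 3) (by positivity)
  obtain ⟨k₂, hk₂⟩ := Metric.tendsto_atTop.1 tendsto_radius δ hδ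
  set k := max k₁ k₂
  obtain ⟨N₁, hN₁⟩ := Metric.tendsto_atTop.1 (tendsto_aronBerner hT hf hM (hmem k)) (ε / 3)
    (by positivity)
  refine ⟨max k N₁, fun N hN => ?_⟩
  have e1 := hk₁ k (le_max_left _ _)
  have e2 := hN₁ N ((le_max_right _ _).trans hN)
  have e3 : dist (f ⟨shrink T N ζ, shrink_mem hT N hζ⟩)
      (extendZero f (T N ((radius k : ℂ) • ζ))) < ε / 3 := by
    rw [dist_eq_norm, ← extendZero_apply (⇑f)]
    refine h _ (shrink_mem hT N hζ) _
      (mem_ball_zero_iff.2 ((hT.norm_le N _).trans_lt (hmem k))) ?_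
    have hNk := hk₂ N (le_trans (le_max_right _ _) ((le_max_left _ _).trans hN))
    have hkk := hk₂ k (le_max_right _ _)
    rw [Real.dist_eq, abs_lt] at hNk hkk
    rw [shrink_apply, map_smul, ← sub_smul, norm_smul, ← Complex.ofReal_sub, Complex.norm_real]
    have h1 : |radius N - radius k| < δ := by
      rw [abs_lt]
      constructor <;> linarith [radius_lt_one N, radius_lt_one k]
    calc |radius N - radius k| * ‖T N ζ‖ ≤ |radius N - radius k| * 1 := by
          gcongr
          exact (hT.norm_le N ζ).trans hζ
      _ < δ := by rwa [mul_one]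
  have t1 := dist_triangle4 (f ⟨shrink T N ζ, shrink_mem hT N hζ⟩)
    (extendZero f (T N ((radius k : ℂ) • ζ))) (aronBerner f ((radius k : ℂ) • ζ))
    (canonicalExtension f ζ)
  refine t1.trans_lt ?_
  rw [Function.comp_apply] at e1
  linarith

theorem norm_canonicalExtension_le (hT : IsArensApproximation T) (f : AU E) {ζ : Bidual E}
    (hζ : ‖ζ‖ ≤ 1) :
    ‖canonicalExtension (f : ball (0 : E) 1 →ᵇ ℂ) ζ‖ ≤ ‖f‖ :=
  le_of_tendsto (tendsto_canonicalExtension hT f hζ).norm <|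
    Eventually.of_forall fun _ => (f : ball (0 : E) 1 →ᵇ ℂ).norm_coe_le_norm _

/-! ### Gleason distance along analytic discs -/

/-- Along an analytic disc in the closed ball of the bidual, the values of the canonical extension
at the centre and at parameter `1 / 2` differ by at most `1`, by the Schwarz lemma. -/
theorem norm_canonicalExtension_sub_le (hT : IsArensApproximation T) (f : AU E)
    (hf : ‖f‖ ≤ 1) {ζ κ : Bidual E}
    (h : ∀ t : ℂ, ‖t‖ < 1 → ‖ζ + t • κ‖ ≤ 1) :
    ‖canonicalExtension (f : ball (0 : E) 1 →ᵇ ℂ) ζ -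
      canonicalExtension (f : ball (0 : E) 1 →ᵇ ℂ) (ζ + (1 / 2 : ℂ) • κ)‖ ≤ 1 := by
  have hhalf : ‖(1 / 2 : ℂ)‖ < 1 := by norm_num
  have h0 : ‖ζ‖ ≤ 1 := by simpa only [dual_add_zero_smul] using h 0 (by simp)
  refine le_of_tendsto ((tendsto_canonicalExtension hT f h0).sub
    (tendsto_canonicalExtension hT f (h _ hhalf))).norm (Eventually.of_forall fun N => ?_)
  let u : ℂ → ℂ := fun t => extendZero (f : ball (0 : E) 1 →ᵇ ℂ) (shrink T N (ζ + t • κ))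
  have hu : ∀ t : ℂ, ∀ ht : ‖t‖ < 1,
      u t = (f : ball (0 : E) 1 →ᵇ ℂ) ⟨shrink T N (ζ + t • κ), shrink_mem hT N (h t ht)⟩ :=
    fun t ht => extendZero_apply _ (shrink_mem hT N (h t ht))
  have hu1 : ∀ t : ℂ, ‖t‖ < 1 → ‖u t‖ ≤ 1 := fun t ht => by
    rw [hu t ht]
    exact ((f : ball (0 : E) 1 →ᵇ ℂ).norm_coe_le_norm _).trans hf
  have hd : DifferentiableOn ℂ u (ball 0 1) := by
    refine DifferentiableOn.comp (t := ball 0 1) (f := fun t : ℂ => shrink T N (ζ + t • κ)) f.2.1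
      (differentiable_clm_dual_line (shrink T N) ζ κ).differentiableOn fun t ht => ?_
    exact shrink_mem hT N (h t (mem_ball_zero_iff.1 ht))
  have hs := Complex.dist_le_div_mul_dist_of_mapsTo_ball (R₂ := 2) (z := 1 / 2) hd
    (fun t ht => ?_) (mem_ball_zero_iff.2 hhalf)
  · rw [dist_comm, dist_eq_norm, hu _ hhalf, hu 0 (by simp)] at hs
    simp only [dual_add_zero_smul] at hs
    refine hs.trans ?_
    norm_num
  · rw [mem_closedBall, dist_eq_norm]
    have h1 := hu1 t (mem_ball_zero_iff.1 ht)
    have h2 := hu1 0 (by simp)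
    linarith [norm_sub_le (u t) (u 0)]

/-! ### Composition homomorphisms -/

/-- Composition of the canonical extension with a holomorphic map into the closed ball of the
bidual is holomorphic, as a bounded pointwise limit of holomorphic functions. -/
theorem isHolomorphic_canonicalExtension_comp (hT : IsArensApproximation T) (f : AU E)
    {D : Type*} [NormedAddCommGroup D] [NormedSpace ℂ D] {Z : D → Bidual E}
    (hZ : DifferentiableOn ℂ Z (ball 0 1)) (hZ1 : ∀ x ∈ ball (0 : D) 1, ‖Z x‖ ≤ 1) :
    IsHolomorphic fun x : ball (0 : D) 1 =>
      canonicalExtension (f : ball (0 : E) 1 →ᵇ ℂ) (Z x) := by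
  intro c hc
  obtain ⟨R, hR, hRc⟩ := Metric.isOpen_iff.1 isOpen_ball c hc
  refine DifferentiableAt.differentiableWithinAt ?_
  refine differentiableAt_of_tendsto_of_bounded (M := ‖f‖)
    (u := fun N x => extendZero (f : ball (0 : E) 1 →ᵇ ℂ) (shrink T N (Z x))) hR ?_ ?_ ?_
  · intro N
    refine DifferentiableOn.comp (t := ball 0 1) (f := fun x => shrink T N (Z x)) f.2.1
      (differentiableOn_clm_comp_dual (shrink T N) (hZ.mono hRc)) fun x hx => ?_
    exact shrink_mem hT N (hZ1 x (hRc hx))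
  · intro N x hx
    rw [extendZero_apply _ (shrink_mem hT N (hZ1 x (hRc hx)))]
    exact (f : ball (0 : E) 1 →ᵇ ℂ).norm_coe_le_norm _
  · intro x hx
    rw [extendZero_apply _ (hRc hx)]
    refine (tendsto_canonicalExtension hT f (hZ1 x (hRc hx))).congr fun N => ?_
    rw [extendZero_apply _ (shrink_mem hT N (hZ1 x (hRc hx)))]

theorem IsHolomorphic.continuous {E F : Type*} [NormedAddCommGroup E] [NormedSpace ℂ E]
    [NormedAddCommGroup F] [NormedSpace ℂ F] {f : ball (0 : E) 1 → F} (hf : IsHolomorphic f) :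
    Continuous f := by
  have h := continuousOn_iff_continuous_domRestrict.1 hf.continuousOn
  refine h.congr fun x => ?_
  exact extendZero_apply f x.2

end Approximation

theorem isArensApproximation_trunc : IsArensApproximation (E := c0) trunc :=
  ⟨norm_trunc_le, tendsto_apply_trunc⟩

/-- A holomorphic map from the ball of `c₀` into the closed ball of its bidual induces an element
of the spectrum. -/
theorem comp_mem_spectrumUInfty {Z : c0 → Bidual c0} (hZ : DifferentiableOn ℂ Z (ball 0 1))
    (hZ1 : ∀ x ∈ ball (0 : c0) 1, ‖Z x‖ ≤ 1) :
    (fun (f : AU c0) (x : ball (0 : c0) 1) =>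
      canonicalExtension (f : ball (0 : c0) 1 →ᵇ ℂ) (Z x)) ∈ spectrumUInfty := by
  have hl := fun (f : AU c0) (x : ball (0 : c0) 1) =>
    tendsto_canonicalExtension isArensApproximation_trunc f (hZ1 x.1 x.2)
  let Φ : AU c0 →ₙₐ[ℂ] HInftyAlg c0 :=
    { toFun := fun f => ⟨BoundedContinuousFunction.ofNormedAddCommGroup
        (fun x : ball (0 : c0) 1 => canonicalExtension (f : ball (0 : c0) 1 →ᵇ ℂ) (Z x))
        (isHolomorphic_canonicalExtension_comp isArensApproximation_trunc f hZ hZ1).continuous ‖f‖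
        fun x => norm_canonicalExtension_le isArensApproximation_trunc f (hZ1 x.1 x.2),
        isHolomorphic_canonicalExtension_comp isArensApproximation_trunc f hZ hZ1⟩
      map_smul' := fun a f => Subtype.ext <| BoundedContinuousFunction.ext fun x =>
        tendsto_nhds_unique (hl (a • f) x) ((hl f x).const_smul a)
      map_zero' := Subtype.ext <| BoundedContinuousFunction.ext fun x =>
        tendsto_nhds_unique (hl 0 x) tendsto_const_nhds
      map_add' := fun f g => Subtype.ext <| BoundedContinuousFunction.ext fun x =>
        tendsto_nhds_unique (hl (f + g) x) ((hl f x).add (hl g x))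
      map_mul' := fun f g => Subtype.ext <| BoundedContinuousFunction.ext fun x =>
        tendsto_nhds_unique (hl (f * g) x) ((hl f x).mul (hl g x)) }
  refine ⟨Φ, fun h0 => ?_, fun f x => rfl⟩
  have h1 : (Φ 1 : ball (0 : c0) 1 →ᵇ ℂ) ⟨0, mem_ball_self one_pos⟩ = 1 :=
    tendsto_nhds_unique (hl 1 _) tendsto_const_nhds
  rw [h0] at h1
  exact zero_ne_one h1

/-! ### The identification of `ℓ_∞` with the bidual, and coordinates -/

/-- `toBidual`, with values in `Bidual c0`. -/
def bidualOf (z : ellInfty) : Bidual c0 := toBidual z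

theorem norm_bidualOf_le (z : ellInfty) : ‖bidualOf z‖ ≤ ‖z‖ := by
  unfold bidualOf toBidual
  exact LinearMap.mkContinuous_norm_le _ (norm_nonneg z) _

/-- `toBidual` as a continuous linear map. -/
def toBidualCLM : ellInfty →L[ℂ] Bidual c0 :=
  LinearMap.mkContinuous
    { toFun := bidualOf
      map_add' := fun z w => by
        ext φ
        change ∑' i, φ (unitVec i) * (z i + w i) =
          ∑' i, φ (unitVec i) * z i + ∑' i, φ (unitVec i) * w i
        rw [← (summable_norm_pairing z φ).of_norm.tsum_add (summable_norm_pairing w φ).of_norm]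
        exact tsum_congr fun i => mul_add _ _ _
      map_smul' := fun a z => by
        ext φ
        change ∑' i, φ (unitVec i) * (a * z i) = a * ∑' i, φ (unitVec i) * z i
        rw [← tsum_mul_left]
        exact tsum_congr fun i => by ring } 1 fun z => by
    rw [one_mul]
    exact norm_bidualOf_le z

theorem toBidualCLM_apply (z : ellInfty) : toBidualCLM z = bidualOf z := rfl

theorem bidualOf_coord (z : ellInfty) (i : ℕ) : bidualOf z (coord i) = z i := by
  change ∑' j, coord i (unitVec j) * z j = z i
  rw [tsum_eq_single i]
  · simp [unitVec, c0OfFinset_apply]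
  · intro j hj
    simp [unitVec, c0OfFinset_apply, hj.symm]

/-- The `i`-th coordinate function, as an element of `A_u(B_{c₀})`. -/
def coordAU (i : ℕ) : AU c0 :=
  ⟨BoundedContinuousFunction.ofNormedAddCommGroup (fun x : ball (0 : c0) 1 => coord i x.1)
    ((coord i).continuous.comp continuous_subtype_val) 1
    fun x : ball (0 : c0) 1 => (c0_norm_apply_le x.1 i).trans (mem_ball_zero_iff.1 x.2).le,
    (coord i).differentiable.differentiableOn.congr fun _ hx => extendZero_apply _ hx,
    (coord i).uniformContinuous.comp uniformContinuous_subtype_val⟩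

theorem canonicalExtension_coordAU (i : ℕ) {z : ellInfty} (hz : ‖z‖ ≤ 1) :
    canonicalExtension (coordAU i : ball (0 : c0) 1 →ᵇ ℂ) (bidualOf z) = z i := by
  have hz' := (norm_bidualOf_le z).trans hz
  refine tendsto_nhds_unique
    (tendsto_canonicalExtension isArensApproximation_trunc (coordAU i) hz') ?_
  have h : Tendsto (fun k => (radius k : ℂ)) atTop (𝓝 1) := by
    exact_mod_cast (Complex.continuous_ofReal.tendsto 1).comp tendsto_radius
  have h2 := h.mul (tendsto_trunc (bidualOf z) (coord i))
  rw [one_mul, bidualOf_coord] at h2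
  refine h2.congr fun N => ?_
  change _ = coord i (shrink trunc N (bidualOf z))
  rw [shrink_apply, map_smul, smul_eq_mul]

/-! ### Perturbation of a point that is not extreme -/

/-- A point of the closed unit ball of a normed space which is not extreme is the midpoint of a
nondegenerate segment in the ball. -/
theorem exists_norm_add_sub_le_of_notMem_extremePoints {V : Type*} [NormedAddCommGroup V]
    [NormedSpace ℝ V] {g : V} (hg : g ∈ closedBall (0 : V) 1)
    (h : g ∉ extremePoints ℝ (closedBall (0 : V) 1)) :
    ∃ v : V, v ≠ 0 ∧ ‖g + v‖ ≤ 1 ∧ ‖g - v‖ ≤ 1 := by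
  rw [mem_extremePoints_iff_left] at h
  push Not at h
  obtain ⟨x, hx, y, hy, ⟨a, b, ha, hb, hab, rfl⟩, hne⟩ := h hg
  rw [mem_closedBall_zero_iff] at hx hy
  have hball : ∀ s t : ℝ, 0 ≤ s → 0 ≤ t → s + t = 1 → ‖s • x + t • y‖ ≤ 1 := by
    intro s t hs ht hst
    refine (norm_add_le _ _).trans ?_
    rw [norm_smul, norm_smul, Real.norm_of_nonneg hs, Real.norm_of_nonneg ht]
    nlinarith
  refine ⟨min a b • (x - y), ?_, ?_, ?_⟩
  · refine smul_ne_zero (lt_min ha hb).ne' (sub_ne_zero.2 fun hxy => hne ?_)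
    rw [← hxy, ← add_smul, hab, one_smul]
  · have := hball (a + min a b) (b - min a b)
      (by linarith [lt_min ha hb]) (sub_nonneg.2 (min_le_right a b)) (by linarith)
    convert this using 2
    module
  · have := hball (a - min a b) (b + min a b)
      (sub_nonneg.2 (min_le_left a b)) (by linarith [lt_min ha hb]) (by linarith)
    convert this using 2
    module

/-- By the parallelogram law, `|w ± v| ≤ 1` forces `|v|² ≤ 1 - |w|² ≤ 2 (1 - |w|)`: the square of
the perturbation is dominated by the distance to the unit circle. -/
theorem norm_add_smul_sq_le {w v t : ℂ} (h1 : ‖w + v‖ ≤ 1) (h2 : ‖w - v‖ ≤ 1) (ht : ‖t‖ ≤ 1) :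
    ‖w + t * ((1 / 2) * (v * v))‖ ≤ 1 := by
  have hp := parallelogram_law_with_norm ℝ w v
  have h3 : ‖w + v‖ * ‖w + v‖ ≤ 1 := mul_le_one₀ h1 (norm_nonneg _) h1
  have h4 : ‖w - v‖ * ‖w - v‖ ≤ 1 := mul_le_one₀ h2 (norm_nonneg _) h2
  have h5 : ‖t * ((1 / 2) * (v * v))‖ ≤ 1 / 2 * (‖v‖ * ‖v‖) := by
    rw [norm_mul, norm_mul, norm_mul]
    norm_num
    exact mul_le_of_le_one_left (by positivity) ht
  have h6 := norm_add_le w (t * ((1 / 2) * (v * v)))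
  nlinarith [sq_nonneg (1 - ‖w‖)]

theorem ellInfty_norm_le_one {z : ellInfty} (h : ∀ i, ‖z i‖ ≤ 1) : ‖z‖ ≤ 1 :=
  lp.norm_le_of_forall_le zero_le_one h

theorem ellInfty_norm_add_smul_sq_le {w v : ellInfty} (h1 : ‖w + v‖ ≤ 1) (h2 : ‖w - v‖ ≤ 1)
    {t : ℂ} (ht : ‖t‖ ≤ 1) : ‖w + t • ((1 / 2 : ℂ) • (v * v))‖ ≤ 1 := by
  refine ellInfty_norm_le_one fun i => ?_
  exact norm_add_smul_sq_le
    ((lp.norm_apply_le_norm ENNReal.top_ne_zero (w + v) i).trans h1)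
    ((lp.norm_apply_le_norm ENNReal.top_ne_zero (w - v) i).trans h2) ht

/-- If `g ± h` take values in the closed unit ball of `ℓ_∞`, then composition with `g + h² / 4`
belongs to the Gleason part of `C_g`. -/
theorem comp_add_sq_mem_gleasonPart (g h : HInfty c0 ellInfty)
    (h1 : ∀ x, ‖(g : ball (0 : c0) 1 →ᵇ ellInfty) x + (h : ball (0 : c0) 1 →ᵇ ellInfty) x‖ ≤ 1)
    (h2 : ∀ x, ‖(g : ball (0 : c0) 1 →ᵇ ellInfty) x - (h : ball (0 : c0) 1 →ᵇ ellInfty) x‖ ≤ 1) :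
    (fun (f : AU c0) (x : ball (0 : c0) 1) => canonicalExtension (f : ball (0 : c0) 1 →ᵇ ℂ)
      (toBidualCLM (extendZero (g : ball (0 : c0) 1 →ᵇ ellInfty) x + (1 / 2 : ℂ) • ((1 / 2 : ℂ) •
        (extendZero (h : ball (0 : c0) 1 →ᵇ ellInfty) x *
          extendZero (h : ball (0 : c0) 1 →ᵇ ellInfty) x))))) ∈
      gleasonPart (compositionMap g) := by
  set G := extendZero (g : ball (0 : c0) 1 →ᵇ ellInfty) with hG
  set H := extendZero (h : ball (0 : c0) 1 →ᵇ ellInfty) with hH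
  have hGH : ∀ x ∈ ball (0 : c0) 1, ∀ t : ℂ, ‖t‖ ≤ 1 →
      ‖G x + t • ((1 / 2 : ℂ) • (H x * H x))‖ ≤ 1 := by
    intro x hx t ht
    rw [hG, hH, extendZero_apply _ hx, extendZero_apply _ hx]
    exact ellInfty_norm_add_smul_sq_le (h1 _) (h2 _) ht
  have hhalf : ‖(1 / 2 : ℂ)‖ ≤ 1 := by norm_num
  refine ⟨comp_mem_spectrumUInfty (Z := fun x => toBidualCLM (G x + (1 / 2 : ℂ) •
    ((1 / 2 : ℂ) • (H x * H x)))) ?_ ?_, ?_⟩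
  · have hd : DifferentiableOn ℂ (fun x => G x + (1 / 2 : ℂ) • ((1 / 2 : ℂ) • (H x * H x)))
        (ball 0 1) :=
      DifferentiableOn.fun_add g.2
        (((DifferentiableOn.fun_mul h.2 h.2).fun_const_smul _).fun_const_smul _)
    exact differentiableOn_dual_clm_comp toBidualCLM hd
  · intro x hx
    exact (norm_bidualOf_le _).trans (hGH x hx _ hhalf)
  · refine lt_of_le_of_lt (b := 1) (iSup_le fun f => iSup_le fun hf => iSup_le fun x => ?_)
      ENNReal.one_lt_two
    have hx : (g : ball (0 : c0) 1 →ᵇ ellInfty) x = G x := (extendZero_apply _ x.2).symm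
    have hκ := norm_canonicalExtension_sub_le isArensApproximation_trunc f hf
      (ζ := toBidualCLM (G x)) (κ := toBidualCLM ((1 / 2 : ℂ) • (H x * H x))) fun t ht => by
        have := (norm_bidualOf_le _).trans (hGH x x.2 t ht.le)
        rwa [← toBidualCLM_apply, map_add, map_smul] at this
    rw [← map_smul, ← map_add] at hκ
    rw [← ofReal_norm, ← ENNReal.ofReal_one]
    refine ENNReal.ofReal_le_ofReal ?_
    change ‖canonicalExtension (f : ball (0 : c0) 1 →ᵇ ℂ)
      (toBidualCLM ((g : ball (0 : c0) 1 →ᵇ ellInfty) x)) - _‖ ≤ 1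
    rw [hx]
    exact hκ

end VectorSpectrum

end

theorem mainTheorem4 (g : VectorSpectrum.HInfty VectorSpectrum.c0 VectorSpectrum.ellInfty)
    (hg : g ∈ Metric.closedBall
      (0 : VectorSpectrum.HInfty VectorSpectrum.c0 VectorSpectrum.ellInfty) 1)
    (hiso : VectorSpectrum.IsGleasonIsolated (VectorSpectrum.compositionMap g)) :
    g ∈ Set.extremePoints ℝ (Metric.closedBall
      (0 : VectorSpectrum.HInfty VectorSpectrum.c0 VectorSpectrum.ellInfty) 1) := by
  by_contra hext
  obtain ⟨h, hne, h1, h2⟩ :=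
    VectorSpectrum.exists_norm_add_sub_le_of_notMem_extremePoints hg hext
  have hadd := fun x => ((g + h).1.norm_coe_le_norm x).trans h1
  have hsub := fun x => ((g - h).1.norm_coe_le_norm x).trans h2
  have hmem := VectorSpectrum.comp_add_sq_mem_gleasonPart g h hadd hsub
  rw [hiso, Set.mem_singleton_iff] at hmem
  refine hne (Subtype.ext (BoundedContinuousFunction.ext fun x => ?_))
  ext i
  -- Evaluating both homomorphisms at the coordinate functions shows that `h ^ 2 = 0`.
  have hcoord := congrFun (congrFun hmem (VectorSpectrum.coordAU i)) x
  have hgx : ‖g.1 x‖ ≤ 1 := (g.1.norm_coe_le_norm x).trans (mem_closedBall_zero_iff.1 hg)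
  have hkx := VectorSpectrum.ellInfty_norm_add_smul_sq_le (hadd x) (hsub x)
    (t := 1 / 2) (by norm_num)
  rw [VectorSpectrum.extendZero_apply _ x.2, VectorSpectrum.extendZero_apply _ x.2] at hcoord
  have hsq := (VectorSpectrum.canonicalExtension_coordAU i hkx).symm.trans
    (hcoord.trans (VectorSpectrum.canonicalExtension_coordAU i hgx))
  change g.1 x i + 1 / 2 * (1 / 2 * (h.1 x i * h.1 x i)) = g.1 x i at hsq
  change h.1 x i = 0
  simpa using hsq
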